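/- **Model.** A state $\theta\in\Theta=\{0,1\}$ is revealed at time $T\ge 0$; the common prior probability of $\theta=1$ is $D\in[0,1]$. At each time $t\in[0,T]$ an agent chooses effort $e_t\in[0,1]$ at flow cost $c\,e_t$, with $c>0$. As long as no signal has arrived, a single (good news) signal arrives at Poisson rate $\lambda_\theta e_t$ in state $\theta$, where $\lambda_1>\lambda_0\ge 0$ are constants; once it has arrived, nothing more can be learned and effort stops. (So, for $D\in(0,1)$, the belief in state $1$ drifts down while the agent works without news, and jumps up on news.) Effort and the signal are private to the agent. A (deterministic, dynamic) contract $R$ consists of a message space $M_t$ for each $t\in[0,T]$ and a reward function $R:\big(\prod_{t\in[0,T]} M_t\big)\times\Theta\to[0,1]$, which the principal commits to at time $0$; the agent sends a message $m_t\in M_t$ at every time $t$. A strategy of the agent consists of a measurable effort path $e:[0,T]\to[0,1]$, followed until the signal arrives, a message path $h^N$ used if no signal arrives, and for each $s\in[0,T]$ a message path $h^s$ used if the signal arrives at time $s$, where $h^s_t=h^N_t$ for $t<s$ and $s\mapsto R(h^s,\theta)$ is measurable for each $\theta$. The agent's utility is the reward minus $c$ times the total effort spent, and a best response is a strategy that maximizes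 expected utility over all strategies. A time $\tau\in[0,T]$ is a *stopping time of the agent under $R$* if some best response has $e_t=1$ for $t\le\tau$ and $e_t=0$ for $t>\tau$. The contract $R$ is *optimal* if it has a stopping time $\tau$ such that $\tau'\le\tau$ for every stopping time $\tau'$ of the agent under any contract $R'$. A static scoring rule is a map $P:\Delta(\Theta)\times\Theta\to\mathbb R$; it is proper if $\mathbb E_{\theta\sim\mu}[P(\nu,\theta)]\le \mathbb E_{\theta\sim\mu}[P(\mu,\theta)]$ for all $\mu,\nu\in\Delta(\Theta)$. A contract $R$ is implemented as the static scoring rule $P$ if $M_T=\Delta(\Theta)$ and $R(h,\theta)=P(m_T,\theta)$ for all $\theta\in\Theta$ and every complete message history $h$, where $m_T$ is the last message of $h$. **Theorem.** For every horizon $T\ge0$, every effort cost $c>0$, every prior $D\in[0,1]$ and all arrival rates $\lambda_1>\lambda_0\ge0$, there exists a contract that is optimal among all contracts and is implemented as a proper static scoring rule. -/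

import Mathlib

open MeasureTheory Set

universe u

noncomputable section

namespace SequentialScoring

/-- The single-source (good news only) Poisson learning environment.  The state is a `Bool`,
`true` being the state that is favoured by the signal.  While the agent works and no signal
has arrived yet, the signal arrives at the constant Poisson rate `rate θ` in state `θ`. -/
structure Environment where
  /-- the date at which the state is revealed -/
  T : ℝ
  T_nonneg : 0 ≤ T
  /-- the prior probability of the state `true` -/
  prior : ℝ
  prior_mem : prior ∈ Icc (0 : ℝ) 1
  /-- the flow cost of effort -/
  cost : ℝ
  cost_pos : 0 < cost
  rate : Bool → ℝ
  rate_nonneg : 0 ≤ rate false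
  rate_lt : rate false < rate true

/-- The dates `[0, T]`. -/
abbrev Environment.Time (E : Environment) : Type := Icc (0 : ℝ) E.T

/-- Lebesgue measure on the dates `[0, T]`. -/
def Environment.timeMeasure (E : Environment) : Measure E.Time :=
  Measure.comap Subtype.val volume

/-- The final date `T`. -/
def Environment.last (E : Environment) : E.Time := ⟨E.T, E.T_nonneg, le_refl _⟩

/-- The prior probability of each state. -/
def Environment.priorProb (E : Environment) : Bool → ℝ
  | true => E.prior
  | false => 1 - E.prior

/-- A belief in `Δ(Θ)`, given by the probability of the state `true`. -/
abbrev Belief : Type := Icc (0 : ℝ) 1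

/-- The expected value, under the belief `μ`, of a state-dependent reward `r`. -/
def expectedReward (μ : Belief) (r : Bool → ℝ) : ℝ :=
  (μ : ℝ) * r true + (1 - (μ : ℝ)) * r false

/-- A scoring rule `P : Δ(Θ) × Θ → ℝ` is proper if truthful reports are optimal. -/
def IsProper (P : Belief → Bool → ℝ) : Prop :=
  ∀ μ ν : Belief, expectedReward μ (P ν) ≤ expectedReward μ (P μ)

/-- A (deterministic, dynamic) contract: a message space at each date, and a reward in `[0, 1]`
for each complete history of messages and each state. -/
structure Contract (E : Environment) where
  Msg : E.Time → Type u
  reward : (∀ t, Msg t) → Bool → ℝ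
  reward_mem : ∀ h θ, reward h θ ∈ Icc (0 : ℝ) 1

variable {E : Environment}

/-- A strategy of the agent under the contract `R`: an effort level in `[0, 1]` at each date,
conditional on no earlier signal; the messages sent as long as no signal has arrived; and, for
each possible arrival date `s`, the messages sent if the signal arrives at `s`. -/
structure Strategy (R : Contract.{u} E) where
  effort : E.Time → ℝ
  effort_measurable : Measurable effort
  effort_mem : ∀ t, effort t ∈ Icc (0 : ℝ) 1
  noNews : ∀ t, R.Msg t
  news : E.Time → ∀ t, R.Msg t
  /-- before the arrival date the messages are those of an agent without a signal -/
  nonanticipating : ∀ s t, t < s → news s t = noNews t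
  reward_measurable : ∀ θ, Measurable fun s => R.reward (news s) θ

namespace Strategy

variable {R : Contract.{u} E}

/-- The effort spent up to date `t` if no signal arrives before `t`. -/
def totalEffort (σ : Strategy R) (t : E.Time) : ℝ := ∫ s in Iic t, σ.effort s ∂E.timeMeasure

/-- The probability in state `θ` that no signal arrives up to date `t`. -/
def survival (σ : Strategy R) (θ : Bool) (t : E.Time) : ℝ :=
  Real.exp (-(E.rate θ * σ.totalEffort t))

/-- The density in state `θ` of the arrival date of the signal. -/
def arrivalDensity (σ : Strategy R) (θ : Bool) (t : E.Time) : ℝ :=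
  E.rate θ * σ.effort t * σ.survival θ t

/-- The expected utility in state `θ`: the reward minus `cost` times the effort that was spent,
which ends when the signal arrives. -/
def stateUtility (σ : Strategy R) (θ : Bool) : ℝ :=
  (∫ s, σ.arrivalDensity θ s *
      (R.reward (σ.news s) θ - E.cost * σ.totalEffort s) ∂E.timeMeasure) +
    σ.survival θ E.last * (R.reward σ.noNews θ - E.cost * σ.totalEffort E.last)

/-- The agent's ex ante expected utility. -/
def utility (σ : Strategy R) : ℝ := ∑ θ : Bool, E.priorProb θ * σ.stateUtility θ

/-- `σ` is a best response to the contract, among all effort and reporting strategies. -/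
def IsBestResponse (σ : Strategy R) : Prop := ∀ σ' : Strategy R, σ'.utility ≤ σ.utility

/-- `σ` is the stopping strategy `τ`: full effort until `τ` (or the signal), none afterwards. -/
def StopsAt (σ : Strategy R) (τ : E.Time) : Prop := σ.effort = (Iic τ).indicator 1

end Strategy

namespace Contract

/-- `τ` is a stopping time of the agent under `R`. -/
def HasStoppingTime (R : Contract.{u} E) (τ : E.Time) : Prop :=
  ∃ σ : Strategy R, σ.StopsAt τ ∧ σ.IsBestResponse

/-- `R` is optimal: among all contracts, it maximizes the agent's stopping time. -/
def IsOptimal (R : Contract.{u} E) : Prop :=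
  ∃ τ : E.Time, R.HasStoppingTime τ ∧
    ∀ (R' : Contract.{u} E) (τ' : E.Time), R'.HasStoppingTime τ' → τ' ≤ τ

/-- `R` is implemented as the static scoring rule `P`: the last message is a report of a belief,
and the reward is the score of that report. -/
def IsStaticScoringRule (R : Contract.{u} E) (P : Belief → Bool → ℝ) : Prop :=
  ∃ e : R.Msg E.last ≃ Belief, ∀ h θ, R.reward h θ = P (e (h E.last)) θ

end Contract

end SequentialScoring

end

noncomputable section

namespace SequentialScoring

open scoped Topology
open TopologicalSpace (NonemptyCompacts)

/-- The sum over the states of the products of weights and rewards. -/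
def pairing (p r : Bool → ℝ) : ℝ := p true * r true + p false * r false

/-- A state-dependent reward with values in `[0, 1]`. -/
abbrev Reward : Type := Bool → Icc (0 : ℝ) 1

/-- The real-valued function underlying a reward. -/
def Reward.val (r : Reward) : Bool → ℝ := fun θ => r θ

/-- A nonempty compact set of rewards. -/
abbrev Menu : Type := NonemptyCompacts Reward

theorem continuous_pairing_val (p : Bool → ℝ) : Continuous fun r : Reward => pairing p r.val := by
  unfold pairing Reward.val
  fun_prop

/-- The support function of a menu. -/
def support (M : Menu) (p : Bool → ℝ) : ℝ :=
  sSup ((fun r : Reward => pairing p r.val) '' (M : Set Reward))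

theorem isCompact_pairing_image (M : Menu) (p : Bool → ℝ) :
    IsCompact ((fun r : Reward => pairing p r.val) '' (M : Set Reward)) :=
  M.isCompact.image (continuous_pairing_val p)

theorem pairing_le_support {M : Menu} (p : Bool → ℝ) {r : Reward} (hr : r ∈ M) :
    pairing p r.val ≤ support M p :=
  le_csSup (isCompact_pairing_image M p).bddAbove (mem_image_of_mem _ hr)

theorem exists_pairing_eq_support (M : Menu) (p : Bool → ℝ) :
    ∃ r ∈ M, pairing p r.val = support M p :=
  (isCompact_pairing_image M p).sSup_mem (M.nonempty.image _)

theorem support_le {M : Menu} {p : Bool → ℝ} {x : ℝ} (h : ∀ r ∈ M, pairing p r.val ≤ x) :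
    support M p ≤ x := by
  obtain ⟨r, hr, e⟩ := exists_pairing_eq_support M p
  exact e ▸ h r hr

theorem pairing_sub_le (p q : Bool → ℝ) (r s : Reward) :
    pairing p r.val - pairing q s.val ≤
      (|p true| + |p false|) * dist r s + (|p true - q true| + |p false - q false|) := by
  have key : ∀ θ, p θ * r.val θ - q θ * s.val θ ≤ |p θ| * dist r s + |p θ - q θ| := by
    intro θ
    have h1 : |r.val θ - s.val θ| ≤ dist r s := by
      have := dist_le_pi_dist r s θ
      rwa [Subtype.dist_eq, Real.dist_eq] at this
    have h2 : p θ * (r.val θ - s.val θ) ≤ |p θ| * dist r s :=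
      (le_abs_self _).trans (by rw [abs_mul]; gcongr)
    have h3 : (p θ - q θ) * s.val θ ≤ |p θ - q θ| * 1 := by
      refine (le_abs_self _).trans ?_
      rw [abs_mul]
      have : |s.val θ| ≤ 1 := abs_le.2 ⟨by linarith [(s θ).2.1, show s.val θ = s θ from rfl],
        (s θ).2.2⟩
      gcongr
    linarith
  have h1 := key true
  have h2 := key false
  unfold pairing
  linarith

theorem support_sub_le (M N : Menu) (p q : Bool → ℝ) :
    support M p - support N q ≤
      (|p true| + |p false|) * dist M N + (|p true - q true| + |p false - q false|) := by
  obtain ⟨r, hr, e⟩ := exists_pairing_eq_support M p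
  refine le_of_forall_pos_le_add fun ε hε => ?_
  set A := |p true| + |p false| with hA
  have hA0 : 0 ≤ A := by positivity
  have hlt : Metric.hausdorffDist (M : Set Reward) N < dist M N + ε / (A + 1) :=
    lt_add_of_pos_right _ (by positivity)
  obtain ⟨s, hs, hrs⟩ := Metric.exists_dist_lt_of_hausdorffDist_lt hr hlt
    (Metric.hausdorffEDist_ne_top_of_nonempty_of_bounded M.nonempty N.nonempty
      M.isCompact.isBounded N.isCompact.isBounded)
  have h1 := pairing_sub_le p q r s
  have h2 := pairing_le_support q hs
  have h3 : A * dist r s ≤ A * (dist M N + ε / (A + 1)) := by gcongr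
  have h4 : A * (ε / (A + 1)) ≤ ε := by
    rw [mul_div_assoc', div_le_iff₀ (by positivity)]
    nlinarith
  rw [← hA] at h1
  linarith

theorem continuous_support : Continuous fun x : Menu × (Bool → ℝ) => support x.1 x.2 := by
  rw [continuous_iff_continuousAt]
  rintro ⟨M, p⟩
  rw [ContinuousAt, tendsto_iff_dist_tendsto_zero]
  have hlim : Filter.Tendsto (fun x : Menu × (Bool → ℝ) =>
      (|x.2 true| + |x.2 false| + (|p true| + |p false|)) * dist x.1 M +
        (|x.2 true - p true| + |x.2 false - p false|)) (𝓝 (M, p)) (𝓝 0) := by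
    have hc : Continuous (fun x : Menu × (Bool → ℝ) =>
      (|x.2 true| + |x.2 false| + (|p true| + |p false|)) * dist x.1 M +
        (|x.2 true - p true| + |x.2 false - p false|)) := by fun_prop
    simpa using hc.tendsto (M, p)
  refine squeeze_zero (fun _ => dist_nonneg) (fun x => ?_) hlim
  rw [Real.dist_eq]
  have h1 := support_sub_le x.1 M x.2 p
  have h2 := support_sub_le M x.1 p x.2
  rw [dist_comm M, abs_sub_comm (p true), abs_sub_comm (p false)] at h2
  have h3 : 0 ≤ (|x.2 true| + |x.2 false|) * dist x.1 M := by positivity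
  have h4 : 0 ≤ (|p true| + |p false|) * dist x.1 M := by positivity
  rw [abs_le]
  constructor <;> linarith

theorem support_smul (M : Menu) {a : ℝ} (ha : 0 ≤ a) (p : Bool → ℝ) :
    support M (fun θ => a * p θ) = a * support M p := by
  have hp : ∀ r, pairing (fun θ => a * p θ) r = a * pairing p r := fun r => by
    unfold pairing; ring
  apply le_antisymm
  · refine support_le fun r hr => ?_
    rw [hp]
    gcongr
    exact pairing_le_support p hr
  · obtain ⟨r, hr, e⟩ := exists_pairing_eq_support M p
    rw [← e, ← hp]
    exact pairing_le_support _ hr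

namespace Environment

variable (E : Environment)

/-- The probability of the state `θ` and of no signal after an amount `y` of effort. -/
def surv (y : ℝ) (θ : Bool) : ℝ := E.priorProb θ * Real.exp (-(E.rate θ * y))

/-- The density, per unit of effort, of the state `θ` and of an arrival of the signal after an
amount `y` of effort. -/
def arr (y : ℝ) (θ : Bool) : ℝ := E.rate θ * E.surv y θ

theorem rate_nonneg' (θ : Bool) : 0 ≤ E.rate θ := by
  cases θ
  · exact E.rate_nonneg
  · exact E.rate_nonneg.trans E.rate_lt.le

theorem priorProb_nonneg (θ : Bool) : 0 ≤ E.priorProb θ := by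
  cases θ
  · exact sub_nonneg.2 E.prior_mem.2
  · exact E.prior_mem.1

theorem surv_nonneg (y : ℝ) (θ : Bool) : 0 ≤ E.surv y θ :=
  mul_nonneg (E.priorProb_nonneg θ) (Real.exp_pos _).le

theorem arr_nonneg (y : ℝ) (θ : Bool) : 0 ≤ E.arr y θ :=
  mul_nonneg (E.rate_nonneg' θ) (E.surv_nonneg y θ)

@[fun_prop]
theorem continuous_surv : Continuous E.surv := by
  unfold surv
  fun_prop

@[fun_prop]
theorem continuous_arr : Continuous E.arr := by
  unfold arr surv
  fun_prop

theorem hasDerivAt_surv (θ : Bool) (y : ℝ) : HasDerivAt (E.surv · θ) (-E.arr y θ) y := by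
  have h := (((hasDerivAt_id y).const_mul (E.rate θ)).neg.exp).const_mul (E.priorProb θ)
  refine h.congr_deriv ?_
  simp only [arr, surv, id, Pi.neg_apply]
  ring

/-- The effort cost of a total effort `y`, weighted by the weights `p`. -/
def costOf (p : Bool → ℝ) (y : ℝ) : ℝ := E.cost * y * (p true + p false)

/-- The value of working until `t`, when the rewards in the menu `M` are offered. -/
def value (M : Menu) (t : ℝ) : ℝ :=
  (∫ y in (0 : ℝ)..t, (support M (E.arr y) - E.costOf (E.arr y) y)) +
    (support M (E.surv t) - E.costOf (E.surv t) t)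

theorem continuous_support_arr : Continuous fun x : Menu × ℝ => support x.1 (E.arr x.2) :=
  continuous_support.comp (continuous_fst.prodMk (E.continuous_arr.comp continuous_snd))

theorem continuous_support_surv : Continuous fun x : Menu × ℝ => support x.1 (E.surv x.2) :=
  continuous_support.comp (continuous_fst.prodMk (E.continuous_surv.comp continuous_snd))

@[fun_prop]
theorem continuous_costOf : Continuous fun x : (Bool → ℝ) × ℝ => E.costOf x.1 x.2 := by
  unfold costOf
  fun_prop

theorem continuous_flow :
    Continuous fun x : Menu × ℝ => support x.1 (E.arr x.2) - E.costOf (E.arr x.2) x.2 := by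
  refine E.continuous_support_arr.sub ?_
  exact E.continuous_costOf.comp ((E.continuous_arr.comp continuous_snd).prodMk continuous_snd)

theorem continuous_value : Continuous fun x : Menu × ℝ => E.value x.1 x.2 := by
  refine Continuous.add ?_ (E.continuous_support_surv.sub
    (E.continuous_costOf.comp ((E.continuous_surv.comp continuous_snd).prodMk continuous_snd)))
  exact intervalIntegral.continuous_parametric_intervalIntegral_of_continuous
    (f := fun (x : Menu × ℝ) y => support x.1 (E.arr y) - E.costOf (E.arr y) y)
    (E.continuous_flow.comp ((continuous_fst.comp continuous_fst).prodMk continuous_snd))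
    continuous_snd

/-- The menus and dates such that working until that date is better than stopping earlier. -/
def implementable : Set (Menu × E.Time) :=
  {x | ∀ t : ℝ, 0 ≤ t → E.value x.1 (min t x.2) ≤ E.value x.1 x.2}

theorem isClosed_implementable : IsClosed E.implementable := by
  have hc : ∀ s : Menu × E.Time → ℝ, Continuous s → Continuous fun x => E.value x.1 (s x) :=
    fun s hs => E.continuous_value.comp (continuous_fst.prodMk hs)
  simp only [implementable, ofPred_forall]
  exact isClosed_iInter fun t => isClosed_iInter fun _ =>
    isClosed_le (hc _ (by fun_prop)) (hc _ (by fun_prop))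

/-- There is a latest date that can be implemented by a menu. -/
theorem exists_latest_implementable :
    ∃ x ∈ E.implementable, ∀ y ∈ E.implementable, y.2 ≤ x.2 := by
  have hne : E.implementable.Nonempty := by
    refine ⟨(⟨⟨univ, isCompact_univ⟩, univ_nonempty⟩, ⟨0, le_rfl, E.T_nonneg⟩), fun t ht => ?_⟩
    simp [min_eq_right ht]
  obtain ⟨x, hx, h⟩ := E.isClosed_implementable.isCompact.exists_isMaxOn hne
    (continuous_snd.continuousOn)
  exact ⟨x, hx, fun y hy => h hy⟩

end Environment

namespace Environment

variable (E : Environment)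

/-- The date in `[0, T]` that is closest to a given real number. -/
def clamp : ℝ → E.Time := projIcc 0 E.T E.T_nonneg

theorem clamp_coe (t : E.Time) : E.clamp t = t := projIcc_val _ t

theorem coe_clamp {z : ℝ} (hz : z ∈ Icc 0 E.T) : (E.clamp z : ℝ) = z := by
  rw [clamp, projIcc_of_mem _ hz]

theorem measurable_clamp : Measurable E.clamp := continuous_projIcc.measurable

theorem setIntegral_timeMeasure (f : E.Time → ℝ) (t : E.Time) :
    ∫ s in Iic t, f s ∂E.timeMeasure = ∫ z in (0 : ℝ)..t, f (E.clamp z) := by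
  rw [← integral_indicator measurableSet_Iic]
  have h1 : ∀ s : E.Time, (Iic t).indicator f s =
      (fun z : ℝ => (Iic (t : ℝ)).indicator (fun z => f (E.clamp z)) z) s := by
    intro s
    by_cases hs : s ≤ t
    · have hs' : (s : ℝ) ≤ t := hs
      simp [indicator, hs, hs', clamp_coe]
    · have hs' : ¬ (s : ℝ) ≤ t := hs
      simp [indicator, hs, hs']
  simp_rw [h1]
  rw [timeMeasure, integral_subtype_comap measurableSet_Icc, setIntegral_indicator measurableSet_Iic,
    intervalIntegral.integral_of_le t.2.1, ← integral_Icc_eq_integral_Ioc]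
  congr 2
  ext z
  have := t.2.2
  constructor
  · rintro ⟨h, h'⟩
    exact ⟨h.1, h'⟩
  · rintro ⟨h, h'⟩
    exact ⟨⟨h, h'.trans this⟩, h'⟩

theorem integral_timeMeasure (f : E.Time → ℝ) :
    ∫ s, f s ∂E.timeMeasure = ∫ z in (0 : ℝ)..E.T, f (E.clamp z) := by
  have h := E.setIntegral_timeMeasure f E.last
  rwa [show Iic E.last = univ from eq_univ_of_forall fun s => s.2.2, Measure.restrict_univ] at h

end Environment

theorem intervalIntegrable_of_mem_Icc {f : ℝ → ℝ} (hf : Measurable f)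
    (h : ∀ z, f z ∈ Icc (0 : ℝ) 1) (a b : ℝ) : IntervalIntegrable f volume a b := by
  refine (intervalIntegrable_const (c := (1 : ℝ))).mono_fun hf.aestronglyMeasurable
    (Filter.Eventually.of_forall fun z => ?_)
  simpa [abs_of_nonneg (h z).1] using (h z).2

variable {E : Environment}

namespace Strategy

variable {R : Contract.{u} E} (σ : Strategy R)

/-- The effort path, as a function on the real line. -/
def path (z : ℝ) : ℝ := σ.effort (E.clamp z)

/-- The cumulative effort, as a function on the real line. -/
def cum (t : ℝ) : ℝ := ∫ z in (0 : ℝ)..t, σ.path z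

/-- The reward that is obtained if the signal arrives at a given date. -/
def payoff (z : ℝ) (θ : Bool) : ℝ := R.reward (σ.news (E.clamp z)) θ

theorem measurable_path : Measurable σ.path := σ.effort_measurable.comp E.measurable_clamp

theorem path_mem (z : ℝ) : σ.path z ∈ Icc (0 : ℝ) 1 := σ.effort_mem _

theorem measurable_payoff (θ : Bool) : Measurable (σ.payoff · θ) :=
  (σ.reward_measurable θ).comp E.measurable_clamp

theorem payoff_mem (z : ℝ) (θ : Bool) : σ.payoff z θ ∈ Icc (0 : ℝ) 1 := R.reward_mem _ _

theorem intervalIntegrable_path (a b : ℝ) : IntervalIntegrable σ.path volume a b :=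
  intervalIntegrable_of_mem_Icc σ.measurable_path σ.path_mem a b

theorem continuous_cum : Continuous σ.cum :=
  intervalIntegral.continuous_primitive σ.intervalIntegrable_path 0

theorem totalEffort_eq (t : E.Time) : σ.totalEffort t = σ.cum t :=
  E.setIntegral_timeMeasure _ _

theorem intervalIntegrable_payoff_mul {f : ℝ → ℝ} (hf : Continuous f) (θ : Bool) (a b : ℝ) :
    IntervalIntegrable (fun z => f z * σ.payoff z θ) volume a b :=
  (intervalIntegrable_of_mem_Icc (σ.measurable_payoff θ) (σ.payoff_mem · θ) a b).continuousOn_mul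
    hf.continuousOn

theorem intervalIntegrable_pairing_payoff {f : ℝ → Bool → ℝ} (hf : Continuous f) (a b : ℝ) :
    IntervalIntegrable (fun z => pairing (f z) (σ.payoff z)) volume a b :=
  (σ.intervalIntegrable_payoff_mul ((continuous_apply true).comp hf) true a b).add
    (σ.intervalIntegrable_payoff_mul ((continuous_apply false).comp hf) false a b)

theorem intervalIntegrable_path_mul {f : ℝ → ℝ} (hf : Measurable f) (hf' : ∀ z, |f z| ≤ 1)
    {g : ℝ → ℝ} (hg : Continuous g) (a b : ℝ) :
    IntervalIntegrable (fun z => σ.path z * (g z * f z)) volume a b := by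
  have h : IntervalIntegrable (fun z => σ.path z * f z) volume a b := by
    refine (intervalIntegrable_const (c := (1 : ℝ))).mono_fun
      (σ.measurable_path.mul hf).aestronglyMeasurable (Filter.Eventually.of_forall fun z => ?_)
    dsimp only
    rw [norm_one, norm_mul, Real.norm_of_nonneg (σ.path_mem z).1]
    exact mul_le_one₀ (σ.path_mem z).2 (norm_nonneg _) (hf' z)
  refine (h.continuousOn_mul hg.continuousOn).congr (fun z _ => ?_)
  ring

theorem intervalIntegrable_path_mul_payoff {g : ℝ → ℝ} (hg : Continuous g) (θ : Bool) (a b : ℝ) :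
    IntervalIntegrable (fun z => σ.path z * (g z * σ.payoff z θ)) volume a b :=
  σ.intervalIntegrable_path_mul (σ.measurable_payoff θ) (fun z => by
    rw [abs_of_nonneg (σ.payoff_mem z θ).1]; exact (σ.payoff_mem z θ).2) hg a b

theorem intervalIntegrable_path_mul_continuous {g : ℝ → ℝ} (hg : Continuous g) (a b : ℝ) :
    IntervalIntegrable (fun z => σ.path z * g z) volume a b := by
  simpa using σ.intervalIntegrable_path_mul (f := fun _ => 1) measurable_const (by simp) hg a b

theorem intervalIntegrable_path_mul_flow (a b : ℝ) : IntervalIntegrable (fun z =>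
    σ.path z * (pairing (E.arr (σ.cum z)) (σ.payoff z) - E.costOf (E.arr (σ.cum z)) (σ.cum z)))
      volume a b := by
  have hc := σ.continuous_cum
  have ha : ∀ θ, Continuous fun z => E.arr (σ.cum z) θ := fun θ =>
    (continuous_apply θ).comp (E.continuous_arr.comp hc)
  have hcost : Continuous fun z => E.costOf (E.arr (σ.cum z)) (σ.cum z) :=
    E.continuous_costOf.comp ((E.continuous_arr.comp hc).prodMk hc)
  refine (((σ.intervalIntegrable_path_mul_payoff (ha true) true a b).add
    (σ.intervalIntegrable_path_mul_payoff (ha false) false a b)).sub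
      (σ.intervalIntegrable_path_mul_continuous hcost a b)).congr (fun z _ => ?_)
  simp only [pairing]
  ring

theorem priorProb_mul_stateUtility (θ : Bool) : E.priorProb θ * σ.stateUtility θ =
    (∫ z in (0 : ℝ)..E.T, σ.path z *
      (E.arr (σ.cum z) θ * σ.payoff z θ - E.cost * σ.cum z * E.arr (σ.cum z) θ)) +
    E.surv (σ.cum E.T) θ * (R.reward σ.noNews θ - E.cost * σ.cum E.T) := by
  rw [stateUtility, mul_add, E.integral_timeMeasure, ← intervalIntegral.integral_const_mul]
  congr 1
  · refine intervalIntegral.integral_congr fun z hz => ?_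
    rw [uIcc_of_le E.T_nonneg] at hz
    simp only [arrivalDensity, survival, totalEffort_eq, E.coe_clamp hz, Environment.arr,
      Environment.surv, path, payoff]
    ring
  · rw [survival, totalEffort_eq, Environment.surv, show (E.last : ℝ) = E.T from rfl]
    ring

theorem utility_eq : σ.utility =
    (∫ z in (0 : ℝ)..E.T, σ.path z *
      (pairing (E.arr (σ.cum z)) (σ.payoff z) - E.costOf (E.arr (σ.cum z)) (σ.cum z))) +
    (pairing (E.surv (σ.cum E.T)) (R.reward σ.noNews) -
      E.costOf (E.surv (σ.cum E.T)) (σ.cum E.T)) := by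
  have hc := σ.continuous_cum
  have ha : ∀ θ, Continuous fun z => E.arr (σ.cum z) θ := fun θ =>
    (continuous_apply θ).comp (E.continuous_arr.comp hc)
  have hint : ∀ θ, IntervalIntegrable (fun z => σ.path z *
      (E.arr (σ.cum z) θ * σ.payoff z θ - E.cost * σ.cum z * E.arr (σ.cum z) θ))
        volume 0 E.T := fun θ => by
    refine ((σ.intervalIntegrable_path_mul_payoff (ha θ) θ 0 E.T).sub
      (σ.intervalIntegrable_path_mul_continuous
        (g := fun z => E.cost * σ.cum z * E.arr (σ.cum z) θ)
        ((continuous_const.mul hc).mul (ha θ)) 0 E.T)).congr (fun z _ => ?_)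
    ring
  rw [utility, Fintype.sum_bool, priorProb_mul_stateUtility, priorProb_mul_stateUtility,
    add_add_add_comm, ← intervalIntegral.integral_add (hint true) (hint false)]
  congr 1
  · refine intervalIntegral.integral_congr fun z _ => ?_
    simp only [pairing, Environment.costOf]
    ring
  · simp only [pairing, Environment.costOf]
    ring

variable {σ}

theorem StopsAt.cum_eq {τ : E.Time} (h : σ.StopsAt τ) {z : ℝ} (hz : z ∈ Icc 0 E.T) :
    σ.cum z = min z τ := by
  have h1 : σ.totalEffort (E.clamp z) = min z τ := by
    rw [totalEffort, h, setIntegral_indicator measurableSet_Iic, Iic_inter_Iic,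
      E.setIntegral_timeMeasure]
    simp only [Pi.one_apply, intervalIntegral.integral_const, smul_eq_mul, mul_one, sub_zero]
    rw [← E.coe_clamp hz]
    simp only [E.clamp_coe]
    exact (Subtype.mono_coe _).map_min
  rw [← h1, totalEffort_eq, E.coe_clamp hz]

/-- The utility of a strategy that works until `τ`. -/
theorem StopsAt.utility_eq {τ : E.Time} (h : σ.StopsAt τ) : σ.utility =
    (∫ z in (0 : ℝ)..τ, (pairing (E.arr z) (σ.payoff z) - E.costOf (E.arr z) z)) +
      (pairing (E.surv τ) (R.reward σ.noNews) - E.costOf (E.surv τ) τ) := by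
  rw [Strategy.utility_eq, h.cum_eq ⟨E.T_nonneg, le_rfl⟩, min_eq_right τ.2.2]
  congr 1
  rw [← intervalIntegral.integral_indicator (a₁ := 0) (a₃ := E.T) τ.2]
  refine intervalIntegral.integral_congr fun z hz => ?_
  rw [uIcc_of_le E.T_nonneg] at hz
  have hp : σ.path z = if z ≤ τ then 1 else 0 := by
    rw [path, h]
    have : E.clamp z ≤ τ ↔ z ≤ (τ : ℝ) := by
      rw [← Subtype.coe_le_coe, E.coe_clamp hz]
    simp [indicator, this]
  by_cases hzt : z ≤ τ
  · simp [hp, hzt, indicator, h.cum_eq hz]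
  · simp [hp, hzt, indicator]

end Strategy

/-- A change of variables along the primitive of a function with values in `[0, 1]`. -/
theorem integral_mul_comp_primitive {e f : ℝ → ℝ} (he : Measurable e)
    (he' : ∀ z, e z ∈ Icc (0 : ℝ) 1) (hf : Continuous f) {T : ℝ} (hT : 0 ≤ T) :
    ∫ z in (0 : ℝ)..T, e z * f (∫ y in (0 : ℝ)..z, e y) =
      ∫ y in (0 : ℝ)..(∫ y in (0 : ℝ)..T, e y), f y := by
  have hint := intervalIntegrable_of_mem_Icc he he'
  set x : ℝ → ℝ := fun z => ∫ y in (0 : ℝ)..z, e y with hx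
  have hxlip : ∀ a b, |x b - x a| ≤ |b - a| := fun a b => by
    rw [hx]
    simp only
    rw [intervalIntegral.integral_interval_sub_left (hint 0 b) (hint 0 a), ← Real.norm_eq_abs,
      ← one_mul |b - a|]
    refine intervalIntegral.norm_integral_le_of_norm_le_const fun z _ => ?_
    rw [Real.norm_of_nonneg (he' z).1]
    exact (he' z).2
  have hxmem : ∀ z ∈ Icc 0 T, x z ∈ Icc (-T) T := fun z hz => by
    have := hxlip 0 z
    simp only [hx, intervalIntegral.integral_same, sub_zero] at this
    rw [abs_of_nonneg hz.1] at this
    exact abs_le.1 (this.trans hz.2)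
  set F : ℝ → ℝ := fun y => ∫ z in (0 : ℝ)..y, f z with hF
  have hFd : ∀ y, HasDerivAt F (f y) y := fun y => hf.integral_hasStrictDerivAt 0 y |>.hasDerivAt
  obtain ⟨C, hC⟩ := (isCompact_Icc (a := -T) (b := T)).exists_bound_of_continuousOn hf.continuousOn
  have hC0 : 0 ≤ C := (norm_nonneg _).trans (hC 0 ⟨by linarith, hT⟩)
  have hlip : LipschitzOnWith ⟨C, hC0⟩ (F ∘ x) (uIcc 0 T) := by
    refine LipschitzOnWith.of_dist_le_mul fun a ha b hb => ?_
    rw [uIcc_of_le hT] at ha hb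
    rw [dist_comm, dist_comm a, Real.dist_eq, Real.dist_eq, Function.comp, Function.comp, hF]
    simp only
    rw [intervalIntegral.integral_interval_sub_left (hf.intervalIntegrable _ _)
      (hf.intervalIntegrable _ _), ← Real.norm_eq_abs]
    refine (intervalIntegral.norm_integral_le_of_norm_le_const (C := C) fun z hz => hC z ?_).trans ?_
    · exact uIcc_subset_Icc (hxmem a ha) (hxmem b hb) (uIoc_subset_uIcc hz)
    · exact mul_le_mul_of_nonneg_left (hxlip a b) hC0
  have h := hlip.absolutelyContinuousOnInterval.integral_deriv_eq_sub
  have h0 : (F ∘ x) 0 = 0 := by simp [hF, hx]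
  rw [h0, sub_zero] at h
  refine Eq.trans (intervalIntegral.integral_congr_ae ?_) h
  filter_upwards [(hint 0 T).ae_hasDerivAt_integral] with z hz hz'
  have hd := (hFd (x z)).comp z (hz (uIoc_subset_uIcc hz') 0 left_mem_uIcc)
  rw [hd.deriv, mul_comm]

namespace Strategy

variable {R : Contract.{u} E}

/-- When all rewards belong to a menu, no strategy does better than working for the same total
amount of time at full effort and then choosing optimally from the menu. -/
theorem utility_le_value (σ : Strategy R) {M : Menu}
    (hM : ∀ h, (fun θ => ⟨R.reward h θ, R.reward_mem h θ⟩ : Reward) ∈ M) :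
    σ.utility ≤ E.value M (σ.cum E.T) := by
  have hle : ∀ p h, pairing p (R.reward h) ≤ support M p := fun p h =>
    pairing_le_support p (hM h)
  have hf : Continuous fun y => support M (E.arr y) - E.costOf (E.arr y) y :=
    E.continuous_flow.comp (continuous_const.prodMk continuous_id)
  have key : ∫ z in (0 : ℝ)..E.T, σ.path z *
      (support M (E.arr (σ.cum z)) - E.costOf (E.arr (σ.cum z)) (σ.cum z)) =
      ∫ y in (0 : ℝ)..σ.cum E.T, (support M (E.arr y) - E.costOf (E.arr y) y) :=
    integral_mul_comp_primitive σ.measurable_path σ.path_mem hf E.T_nonneg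
  rw [utility_eq, Environment.value, ← key]
  refine add_le_add (intervalIntegral.integral_mono_on E.T_nonneg
    (σ.intervalIntegrable_path_mul_flow _ _)
    (σ.intervalIntegrable_path_mul_continuous (hf.comp σ.continuous_cum) _ _) fun z _ => ?_)
    (sub_le_sub_right (hle _ _) _)
  exact mul_le_mul_of_nonneg_left (sub_le_sub_right (hle _ _) _) (σ.path_mem z).1

theorem cum_last_mem (σ : Strategy R) : σ.cum E.T ∈ Icc 0 E.T := by
  have h1 : ∫ _ in (0 : ℝ)..E.T, (1 : ℝ) = E.T := by simp
  constructor
  · exact intervalIntegral.integral_nonneg E.T_nonneg fun z _ => (σ.path_mem z).1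
  · calc σ.cum E.T ≤ ∫ _ in (0 : ℝ)..E.T, (1 : ℝ) :=
          intervalIntegral.integral_mono_on E.T_nonneg (σ.intervalIntegrable_path _ _)
            intervalIntegrable_const fun z _ => (σ.path_mem z).2
      _ = E.T := h1

end Strategy

/-- A reward that is worse without a signal now and worse after an earlier signal is also worse
after a signal that arrives now. -/
theorem Environment.pairing_arr_le (E : Environment) {s t : ℝ} (hst : s ≤ t) {q r : Bool → ℝ}
    (h1 : pairing (E.arr s) q ≤ pairing (E.arr s) r)
    (h2 : pairing (E.surv t) q < pairing (E.surv t) r) :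
    pairing (E.arr t) q ≤ pairing (E.arr t) r := by
  have hexp : ∀ θ, E.surv t θ = E.surv s θ * Real.exp (-(E.rate θ * (t - s))) := fun θ => by
    rw [surv, surv, mul_assoc, ← Real.exp_add]
    congr 2
    ring
  have h1s := E.surv_nonneg s true
  have h0s := E.surv_nonneg s false
  have h1t := E.surv_nonneg t true
  have h0t := E.surv_nonneg t false
  have hl := E.rate_lt
  have hl0 := E.rate_nonneg
  simp only [pairing, arr] at h1 h2 ⊢
  rcases le_total (q true) (r true) with hq | hq
  · nlinarith [mul_nonneg (sub_nonneg.2 hl.le) (mul_nonneg h1t (sub_nonneg.2 hq)),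
      mul_nonneg hl0 (sub_nonneg.2 h2.le)]
  · have h0 : q false ≤ r false := by
      by_contra! hlt
      nlinarith [mul_nonneg h1t (sub_nonneg.2 hq), mul_nonneg h0t (sub_nonneg.2 hlt.le)]
    have he : Real.exp (-(E.rate true * (t - s))) ≤ Real.exp (-(E.rate false * (t - s))) := by
      apply Real.exp_le_exp.2
      nlinarith [sub_nonneg.2 hst]
    rw [hexp, hexp]
    set x := Real.exp (-(E.rate true * (t - s))) with hx
    set y := Real.exp (-(E.rate false * (t - s))) with hy
    have hx0 : 0 < x := Real.exp_pos _
    have key : 0 ≤ E.rate false * E.surv s false * (r false - q false) * (y - x) :=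
      mul_nonneg (mul_nonneg (mul_nonneg hl0 h0s) (sub_nonneg.2 h0)) (sub_nonneg.2 he)
    have key' := mul_le_mul_of_nonneg_left h1 hx0.le
    linarith

namespace Strategy

variable {R : Contract.{u} E} (σ : Strategy R)

/-- The flow of utility at the date `z` while working. -/
def flow (z : ℝ) : ℝ := pairing (E.arr z) (σ.payoff z) - E.costOf (E.arr z) z

/-- The utility from working until `t` and obtaining the reward `r` if no signal has arrived. -/
def stopPayoff (r : Bool → ℝ) (t : ℝ) : ℝ :=
  (∫ z in (0 : ℝ)..t, σ.flow z) + (pairing (E.surv t) r - E.costOf (E.surv t) t)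

theorem intervalIntegrable_flow (a b : ℝ) : IntervalIntegrable σ.flow volume a b :=
  (σ.intervalIntegrable_pairing_payoff E.continuous_arr a b).sub
    ((E.continuous_costOf.comp (E.continuous_arr.prodMk continuous_id)).intervalIntegrable a b)

theorem hasDerivAt_terminal (E : Environment) (r : Bool → ℝ) (t : ℝ) :
    HasDerivAt (fun t => pairing (E.surv t) r - E.costOf (E.surv t) t)
      (E.costOf (E.arr t) t - pairing (E.arr t) r - E.cost * (E.surv t true + E.surv t false)) t := by
  have h1 := E.hasDerivAt_surv true t
  have h0 := E.hasDerivAt_surv false t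
  have h := ((h1.mul_const (r true)).add (h0.mul_const (r false))).sub
    (((hasDerivAt_id t).const_mul E.cost).mul (h1.add h0))
  refine h.congr_deriv ?_
  simp only [pairing, Environment.costOf, id, Pi.add_apply]
  ring

theorem continuous_terminal (E : Environment) (r : Bool → ℝ) :
    Continuous (fun t => pairing (E.surv t) r - E.costOf (E.surv t) t) :=
  continuous_iff_continuousAt.2 fun t => (hasDerivAt_terminal E r t).continuousAt

theorem continuous_stopPayoff (r : Bool → ℝ) : Continuous (σ.stopPayoff r) :=
  (intervalIntegral.continuous_primitive σ.intervalIntegrable_flow 0).add (continuous_terminal E r)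

theorem stopPayoff_sub (r : Bool → ℝ) (a b : ℝ) : σ.stopPayoff r b - σ.stopPayoff r a =
    ∫ z in a..b, (pairing (E.arr z) (σ.payoff z) - pairing (E.arr z) r -
      E.cost * (E.surv z true + E.surv z false)) := by
  have hc : Continuous fun t =>
      E.costOf (E.arr t) t - pairing (E.arr t) r - E.cost * (E.surv t true + E.surv t false) := by
    have h1 := E.continuous_arr
    have h2 := E.continuous_surv
    unfold Environment.costOf pairing
    fun_prop
  have h := intervalIntegral.integral_eq_sub_of_hasDerivAt
    (fun t _ => hasDerivAt_terminal E r t) (hc.intervalIntegrable a b)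
  have h' := intervalIntegral.integral_interval_sub_left (σ.intervalIntegrable_flow 0 b)
    (σ.intervalIntegrable_flow 0 a)
  calc _ = (∫ z in a..b, σ.flow z) + ∫ z in a..b, (E.costOf (E.arr z) z - pairing (E.arr z) r -
          E.cost * (E.surv z true + E.surv z false)) := by
        rw [h, ← h', stopPayoff, stopPayoff]; ring
    _ = _ := by
        rw [← intervalIntegral.integral_add (σ.intervalIntegrable_flow a b)
          (hc.intervalIntegrable a b)]
        refine intervalIntegral.integral_congr fun z _ => ?_
        simp only [flow]
        ring

/-- The strategy that works until `t` and then sends the messages `k`. -/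
def stopAndSend (t : E.Time) (k : ∀ t, R.Msg t) (hk : ∀ s < t, k s = σ.noNews s) : Strategy R where
  effort := (Iic t).indicator 1
  effort_measurable := measurable_one.indicator measurableSet_Iic
  effort_mem s := by
    by_cases h : s ≤ t <;> simp [indicator, h]
  noNews := k
  news s := if s ≤ t then σ.news s else k
  nonanticipating s v hv := by
    split_ifs with h
    · rw [σ.nonanticipating s v hv, hk v (hv.trans_le h)]
    · rfl
  reward_measurable θ := by
    have : (fun s => R.reward (if s ≤ t then σ.news s else k) θ) =
        fun s => if s ≤ t then R.reward (σ.news s) θ else R.reward k θ := by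
      funext s
      split_ifs <;> rfl
    rw [this]
    exact Measurable.ite measurableSet_Iic (σ.reward_measurable θ) measurable_const

theorem utility_stopAndSend (t : E.Time) (k : ∀ t, R.Msg t) (hk : ∀ s < t, k s = σ.noNews s) :
    (σ.stopAndSend t k hk).utility = σ.stopPayoff (R.reward k) t := by
  have hs : (σ.stopAndSend t k hk).StopsAt t := rfl
  rw [hs.utility_eq, stopPayoff]
  congr 1
  refine intervalIntegral.integral_congr fun z hz => ?_
  rw [uIcc_of_le t.2.1] at hz
  have : E.clamp z ≤ t := by
    rw [← Subtype.coe_le_coe, E.coe_clamp ⟨hz.1, hz.2.trans t.2.2⟩]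
    exact hz.2
  have : (σ.stopAndSend t k hk).payoff z = σ.payoff z := by
    funext θ
    simp [payoff, stopAndSend, this]
  simp only [this, flow]

/-- The strategy that sends the messages `k` if the signal arrives at a date in `A`. -/
def sendOn (A : Set E.Time) (hA : MeasurableSet A) (k : ∀ t, R.Msg t)
    (hk : ∀ s ∈ A, ∀ v < s, k v = σ.noNews v) : Strategy R where
  effort := σ.effort
  effort_measurable := σ.effort_measurable
  effort_mem := σ.effort_mem
  noNews := σ.noNews
  news s := by classical exact if s ∈ A then k else σ.news s
  nonanticipating s v hv := by
    split_ifs with h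
    · exact hk s h v hv
    · exact σ.nonanticipating s v hv
  reward_measurable θ := by
    classical
    have : (fun s => R.reward (if s ∈ A then k else σ.news s) θ) =
        fun s => if s ∈ A then R.reward k θ else R.reward (σ.news s) θ := by
      funext s
      split_ifs <;> rfl
    rw [this]
    exact Measurable.ite hA measurable_const (σ.reward_measurable θ)

variable {σ} {τ : E.Time}

theorem IsBestResponse.stopPayoff_le (hσ : σ.IsBestResponse) (t : E.Time) (k : ∀ t, R.Msg t)
    (hk : ∀ s < t, k s = σ.noNews s) : σ.stopPayoff (R.reward k) t ≤ σ.utility :=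
  σ.utility_stopAndSend t k hk ▸ hσ _

/-- A best response reports optimally at almost all arrival dates. -/
theorem IsBestResponse.ae_pairing_le (hσ : σ.IsBestResponse) (hτ : σ.StopsAt τ) (s : E.Time)
    (k : ∀ t, R.Msg t) (hk : ∀ v < s, k v = σ.noNews v) :
    ∀ᵐ z : ℝ, z ∈ Ioc (0 : ℝ) τ → z ≤ s →
      pairing (E.arr z) (R.reward k) ≤ pairing (E.arr z) (σ.payoff z) := by
  have hmeas : ∀ θ, Measurable fun v : E.Time => E.arr v θ := fun θ =>
    (((continuous_apply θ).comp E.continuous_arr).comp continuous_subtype_val).measurable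
  let A : Set E.Time := {v | v ≤ s} ∩
    {v | pairing (E.arr v) (R.reward (σ.news v)) < pairing (E.arr v) (R.reward k)}
  have hA : MeasurableSet A := by
    refine measurableSet_Iic.inter (measurableSet_lt ?_ ?_)
    · exact ((hmeas true).mul (σ.reward_measurable true)).add
        ((hmeas false).mul (σ.reward_measurable false))
    · exact ((hmeas true).mul_const _).add ((hmeas false).mul_const _)
  set σ' := σ.sendOn A hA k (fun v hv w hw => hk w (hw.trans_le hv.1)) with hσ'
  have hτ' : σ'.StopsAt τ := hτ
  have hu := hσ σ'
  rw [hτ'.utility_eq, hτ.utility_eq, show σ'.noNews = σ.noNews from rfl, add_le_add_iff_right] at hu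
  change ∫ z in (0 : ℝ)..τ, σ'.flow z ≤ ∫ z in (0 : ℝ)..τ, σ.flow z at hu
  have hpt : ∀ z ∈ Icc (0 : ℝ) τ, σ.flow z ≤ σ'.flow z ∧
      (z ≤ s → pairing (E.arr z) (R.reward k) ≤ pairing (E.arr z) (σ'.payoff z)) := by
    intro z hz
    have hzc : (E.clamp z : ℝ) = z := E.coe_clamp ⟨hz.1, hz.2.trans τ.2.2⟩
    by_cases hzA : E.clamp z ∈ A
    · have hp : σ'.payoff z = R.reward k := by
        funext θ
        simp [payoff, hσ', sendOn, hzA]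
      have h2 := hzA.2
      simp only [mem_ofPred_eq, hzc] at h2
      refine ⟨?_, fun _ => hp ▸ le_rfl⟩
      simp only [flow, hp]
      exact sub_le_sub_right h2.le _
    · have hp : σ'.payoff z = σ.payoff z := by
        funext θ
        simp [payoff, hσ', sendOn, hzA]
      refine ⟨by simp only [flow, hp, le_refl], fun hzs => ?_⟩
      by_contra! hlt
      rw [hp] at hlt
      refine hzA ⟨?_, ?_⟩
      · change E.clamp z ≤ s
        rw [← Subtype.coe_le_coe, hzc]
        exact hzs
      · simp only [mem_ofPred_eq, hzc]
        exact hlt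
  have hzero : ∫ z in (0 : ℝ)..τ, (σ'.flow z - σ.flow z) = 0 := by
    refine le_antisymm ?_ (intervalIntegral.integral_nonneg τ.2.1 fun z hz =>
      sub_nonneg.2 (hpt z hz).1)
    rw [intervalIntegral.integral_sub (σ'.intervalIntegrable_flow _ _)
      (σ.intervalIntegrable_flow _ _)]
    linarith
  rw [intervalIntegral.integral_eq_zero_iff_of_le_of_nonneg_ae τ.2.1
    ((ae_restrict_iff' measurableSet_Ioc).2 (Filter.Eventually.of_forall fun z hz =>
      sub_nonneg.2 (hpt z (Ioc_subset_Icc_self hz)).1))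
    ((σ'.intervalIntegrable_flow _ _).sub (σ.intervalIntegrable_flow _ _)),
    Filter.EventuallyEq, ae_restrict_iff' measurableSet_Ioc] at hzero
  filter_upwards [hzero] with z hz hzτ hzs
  have h1 := hz hzτ
  have h2 := (hpt z (Ioc_subset_Icc_self hzτ)).2 hzs
  simp only [flow, Pi.zero_apply] at h1
  linarith

theorem IsBestResponse.ae_ae_pairing_le (hσ : σ.IsBestResponse) (hτ : σ.StopsAt τ) :
    ∀ᵐ s : ℝ, ∀ᵐ t : ℝ, s ∈ Ioc (0 : ℝ) τ → t ∈ Icc s τ →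
      pairing (E.arr s) (σ.payoff t) ≤ pairing (E.arr s) (σ.payoff s) := by
  have hmeas : ∀ θ, Measurable fun v : ℝ => E.arr v θ := fun θ =>
    ((continuous_apply θ).comp E.continuous_arr).measurable
  refine (Measure.ae_ae_comm ?_).2 (Filter.Eventually.of_forall fun t => ?_)
  · have h1 : MeasurableSet {x : ℝ × ℝ | x.1 ∈ Ioc (0 : ℝ) τ} := measurable_fst measurableSet_Ioc
    have h2 : MeasurableSet {x : ℝ × ℝ | x.2 ∈ Icc x.1 τ} :=
      (measurableSet_le measurable_fst measurable_snd).inter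
        (measurableSet_le measurable_snd measurable_const)
    have h3 : MeasurableSet {x : ℝ × ℝ |
        pairing (E.arr x.1) (σ.payoff x.2) ≤ pairing (E.arr x.1) (σ.payoff x.1)} := by
      refine measurableSet_le ?_ ?_
      · exact (((hmeas true).comp measurable_fst).mul
          ((σ.measurable_payoff true).comp measurable_snd)).add
            (((hmeas false).comp measurable_fst).mul
              ((σ.measurable_payoff false).comp measurable_snd))
      · exact (((hmeas true).comp measurable_fst).mul
          ((σ.measurable_payoff true).comp measurable_fst)).add
            (((hmeas false).comp measurable_fst).mul
              ((σ.measurable_payoff false).comp measurable_fst))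
    convert h1.compl.union (h2.compl.union h3) using 1
    ext x
    simp only [mem_ofPred_eq, mem_union, mem_compl_iff]
    tauto
  · filter_upwards [hσ.ae_pairing_le hτ (E.clamp t) (σ.news (E.clamp t))
      (fun v hv => σ.nonanticipating _ v hv)] with s hs hs1 ht
    refine hs hs1 ?_
    rw [E.coe_clamp ⟨hs1.1.le.trans ht.1, ht.2.trans τ.2.2⟩]
    exact ht.1

/-- A reward that is available after some arrival date is never attractive without a signal. -/
theorem IsBestResponse.ae_stopPayoff_payoff_le (hσ : σ.IsBestResponse) (hτ : σ.StopsAt τ) :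
    ∀ᵐ s : ℝ, s ∈ Ioc (0 : ℝ) τ → ∀ t ∈ Icc (0 : ℝ) τ,
      σ.stopPayoff (σ.payoff s) t ≤ σ.utility := by
  have hbefore : ∀ s ∈ Icc 0 E.T, ∀ t ∈ Icc 0 s, σ.stopPayoff (σ.payoff s) t ≤ σ.utility := by
    intro s hs t ht
    refine hσ.stopPayoff_le ⟨t, ht.1, ht.2.trans hs.2⟩ (σ.news (E.clamp s)) fun v hv =>
      σ.nonanticipating _ v ?_
    rw [← Subtype.coe_lt_coe, E.coe_clamp hs]
    exact (Subtype.coe_lt_coe.2 hv).trans_le ht.2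
  have hT : Icc (0 : ℝ) τ ⊆ Icc 0 E.T := Icc_subset_Icc_right τ.2.2
  filter_upwards [hσ.ae_ae_pairing_le hτ] with s hs hsτ t ht
  rcases le_total t s with hts | hst
  · exact hbefore s (hT (Ioc_subset_Icc_self hsτ)) t ⟨ht.1, hts⟩
  by_contra! hlt
  set W := σ.stopPayoff (σ.payoff s) with hW
  have hWc : Continuous W := σ.continuous_stopPayoff _
  have hcomp : IsCompact (Icc s t ∩ W ⁻¹' Iic σ.utility) :=
    isCompact_Icc.inter_right (isClosed_Iic.preimage hWc)
  obtain ⟨v, hv, hmax⟩ := hcomp.exists_isGreatest ⟨s, ⟨le_rfl, hst⟩,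
    hbefore s (hT (Ioc_subset_Icc_self hsτ)) s ⟨hsτ.1.le, le_rfl⟩⟩
  have hvU : W v ≤ σ.utility := hv.2
  have hle : W t - W v ≤ 0 := by
    rw [hW, stopPayoff_sub, intervalIntegral.integral_of_le hv.1.2]
    refine integral_nonpos_of_ae ?_
    rw [Filter.EventuallyLE, ae_restrict_iff' measurableSet_Ioc]
    filter_upwards [hs] with z hz hzv
    have hz0 : 0 ≤ z := hsτ.1.le.trans (hv.1.1.trans hzv.1.le)
    have hzτ : z ≤ τ := hzv.2.trans ht.2
    have hsz : s ≤ z := hv.1.1.trans hzv.1.le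
    have h1 : σ.utility < W z := by
      by_contra! hWz
      exact absurd (hmax ⟨⟨hsz, hzv.2⟩, hWz⟩) (not_le.2 hzv.1)
    have h2 := hbefore z (hT ⟨hz0, hzτ⟩) z ⟨hz0, le_rfl⟩
    have h3 : pairing (E.surv z) (σ.payoff z) < pairing (E.surv z) (σ.payoff s) := by
      simp only [hW, stopPayoff] at h1 h2
      linarith
    have h4 := E.pairing_arr_le hsz (hz hsτ ⟨hsz, hzτ⟩) h3
    have h5 : 0 ≤ E.cost * (E.surv z true + E.surv z false) :=
      mul_nonneg E.cost_pos.le (add_nonneg (E.surv_nonneg _ _) (E.surv_nonneg _ _))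
    simp only [Pi.zero_apply]
    linarith
  linarith

end Strategy

/-- A date that is a stopping time of the agent under some contract is implemented by a menu. -/
theorem Contract.HasStoppingTime.exists_menu {E : Environment} {R : Contract.{u} E} {τ : E.Time}
    (h : R.HasStoppingTime τ) : ∃ M : Menu, (M, τ) ∈ E.implementable := by
  obtain ⟨σ, hτ, hσ⟩ := h
  let C : Set Reward := ⋂ t ∈ Icc (0 : ℝ) τ, {r | σ.stopPayoff r.val t ≤ σ.utility}
  have hC : IsClosed C := isClosed_biInter fun t _ => by
    refine isClosed_le (continuous_const.add ((continuous_pairing_val _).sub continuous_const))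
      continuous_const
  let b : Reward := fun θ => ⟨R.reward σ.noNews θ, R.reward_mem _ θ⟩
  have hb : b ∈ C := mem_iInter₂.2 fun t ht =>
    hσ.stopPayoff_le ⟨t, ht.1, ht.2.trans τ.2.2⟩ σ.noNews fun _ _ => rfl
  let M : Menu := ⟨⟨C, hC.isCompact⟩, ⟨b, hb⟩⟩
  refine ⟨M, fun t ht => ?_⟩
  simp only
  set v := min t (τ : ℝ) with hv
  have hv0 : 0 ≤ v := le_min ht τ.2.1
  have hvτ : v ≤ τ := min_le_right _ _
  have hf : ∀ a c, IntervalIntegrable (fun y => support M (E.arr y) - E.costOf (E.arr y) y)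
      volume a c := fun a c =>
    (E.continuous_flow.comp (continuous_const.prodMk continuous_id)).intervalIntegrable a c
  have hae : ∫ z in v..τ, σ.flow z ≤
      ∫ z in v..τ, (support M (E.arr z) - E.costOf (E.arr z) z) := by
    rw [intervalIntegral.integral_of_le hvτ, intervalIntegral.integral_of_le hvτ]
    refine integral_mono_ae (σ.intervalIntegrable_flow v τ).1 (hf v τ).1 ?_
    rw [Filter.EventuallyLE, ae_restrict_iff' measurableSet_Ioc]
    filter_upwards [hσ.ae_stopPayoff_payoff_le hτ] with z hz hzv
    refine sub_le_sub_right (pairing_le_support (M := M) (E.arr z)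
      (r := fun θ => ⟨σ.payoff z θ, σ.payoff_mem z θ⟩) ?_) _
    exact mem_iInter₂.2 fun t ht => hz ⟨hv0.trans_lt hzv.1, hzv.2⟩ t ht
  obtain ⟨r, hr, hre⟩ := exists_pairing_eq_support M (E.surv v)
  have hrU : σ.stopPayoff r.val v ≤ σ.utility := mem_iInter₂.1 hr v ⟨hv0, hvτ⟩
  have hbM : pairing (E.surv τ) (R.reward σ.noNews) ≤ support M (E.surv τ) :=
    pairing_le_support (M := M) (E.surv τ) (r := b) hb
  have hU : σ.utility = (∫ z in (0 : ℝ)..τ, σ.flow z) +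
      (pairing (E.surv τ) (R.reward σ.noNews) - E.costOf (E.surv τ) τ) := hτ.utility_eq
  rw [Strategy.stopPayoff, hre, hU] at hrU
  have e1 := intervalIntegral.integral_add_adjacent_intervals (hf 0 v) (hf v τ)
  have e2 := intervalIntegral.integral_add_adjacent_intervals (σ.intervalIntegrable_flow 0 v)
    (σ.intervalIntegrable_flow v τ)
  rw [Environment.value, Environment.value, ← e1]
  linarith

/-- The probabilities of the states under a belief. -/
def Belief.weight (μ : Belief) : Bool → ℝ
  | true => μ
  | false => 1 - μ

theorem expectedReward_eq_pairing (μ : Belief) (r : Bool → ℝ) :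
    expectedReward μ r = pairing μ.weight r := rfl

/-- The belief that is proportional to given nonnegative weights. -/
def posterior (p : Bool → ℝ) : Belief := projIcc 0 1 zero_le_one (p true / (p true + p false))

theorem mul_weight_posterior {p : Bool → ℝ} (hp : ∀ θ, 0 ≤ p θ) (θ : Bool) :
    (p true + p false) * (posterior p).weight θ = p θ := by
  have h1 := hp true
  have h0 := hp false
  have hmem : p true / (p true + p false) ∈ Icc (0 : ℝ) 1 :=
    ⟨by positivity, div_le_one_of_le₀ (by linarith) (by linarith)⟩
  have hval : ((posterior p : Belief) : ℝ) = p true / (p true + p false) := by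
    rw [posterior, projIcc_of_mem _ hmem]
  have key : (p true + p false) * (p true / (p true + p false)) = p true := by
    rcases (add_nonneg h1 h0).eq_or_lt with h | h
    · rw [← h, zero_mul]
      linarith
    · rw [mul_div_cancel₀ _ h.ne']
  cases θ
  · simp only [Belief.weight, hval, mul_sub, key]
    ring
  · simp only [Belief.weight, hval, key]

/-- The scoring rule that picks, for each belief, an optimal reward from a menu. -/
def menuRule (M : Menu) (μ : Belief) : Bool → ℝ :=
  (exists_pairing_eq_support M μ.weight).choose.val

theorem menuRule_mem (M : Menu) (μ : Belief) :
    ∃ r ∈ M, r.val = menuRule M μ :=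
  ⟨_, (exists_pairing_eq_support M μ.weight).choose_spec.1, rfl⟩

theorem pairing_menuRule (M : Menu) (μ : Belief) :
    pairing μ.weight (menuRule M μ) = support M μ.weight :=
  (exists_pairing_eq_support M μ.weight).choose_spec.2

theorem pairing_menuRule_posterior (M : Menu) {p : Bool → ℝ} (hp : ∀ θ, 0 ≤ p θ) :
    pairing p (menuRule M (posterior p)) = support M p := by
  have hsum : 0 ≤ p true + p false := add_nonneg (hp true) (hp false)
  have h : p = fun θ => (p true + p false) * (posterior p).weight θ :=
    funext fun θ => (mul_weight_posterior hp θ).symm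
  have h2 : support M p = (p true + p false) * support M (posterior p).weight := by
    conv_lhs => rw [h]
    exact support_smul M hsum _
  rw [h2, ← pairing_menuRule]
  have h1 := mul_weight_posterior hp true
  have h0 := mul_weight_posterior hp false
  unfold pairing
  rw [mul_add, ← mul_assoc, ← mul_assoc, h1, h0]

theorem isProper_menuRule (M : Menu) : IsProper (menuRule M) := by
  intro μ ν
  obtain ⟨r, hr, e⟩ := menuRule_mem M ν
  rw [expectedReward_eq_pairing, expectedReward_eq_pairing, pairing_menuRule, ← e]
  exact pairing_le_support _ hr

theorem IsProper.monotone_true {P : Belief → Bool → ℝ} (hP : IsProper P) :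
    Monotone fun μ => P μ true := by
  intro μ ν h
  have h1 := hP μ ν
  have h2 := hP ν μ
  simp only [expectedReward] at h1 h2 ⊢
  rcases eq_or_lt_of_le h with rfl | hlt
  · rfl
  have hlt' : (μ : ℝ) < ν := hlt
  have hμ := μ.2
  have hν := ν.2
  by_contra! hc
  have h3 : 0 ≤ (1 - (ν : ℝ)) := sub_nonneg.2 hν.2
  have h4 : 0 < (1 - (μ : ℝ)) := by linarith
  nlinarith [mul_le_mul_of_nonneg_left h1 h3, mul_le_mul_of_nonneg_left h2 h4.le,
    mul_pos (sub_pos.2 hlt') (sub_pos.2 hc)]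

theorem IsProper.antitone_false {P : Belief → Bool → ℝ} (hP : IsProper P) :
    Antitone fun μ => P μ false := by
  intro μ ν h
  have h1 := hP μ ν
  have h2 := hP ν μ
  simp only [expectedReward] at h1 h2 ⊢
  rcases eq_or_lt_of_le h with rfl | hlt
  · rfl
  have hlt' : (μ : ℝ) < ν := hlt
  have hμ := μ.2
  have hν := ν.2
  by_contra! hc
  nlinarith [mul_le_mul_of_nonneg_left h1 (hμ.1.trans hlt'.le), mul_le_mul_of_nonneg_left h2 hμ.1,
    mul_pos (sub_pos.2 hlt') (sub_pos.2 hc)]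

theorem IsProper.measurable {P : Belief → Bool → ℝ} (hP : IsProper P) (θ : Bool) :
    Measurable fun μ => P μ θ := by
  cases θ
  · exact hP.antitone_false.measurable
  · exact hP.monotone_true.measurable

theorem measurable_posterior : Measurable posterior :=
  continuous_projIcc.measurable.comp
    ((measurable_pi_apply true).div ((measurable_pi_apply true).add (measurable_pi_apply false)))

/-- The contract that asks for a belief at the final date and pays the score of a menu. -/
def menuContract (E : Environment) (M : Menu) : Contract.{u} E where
  Msg _ := ULift.{u} Belief
  reward h θ := menuRule M (h E.last).down θ
  reward_mem h θ := by
    obtain ⟨r, -, e⟩ := menuRule_mem M (h E.last).down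
    exact e ▸ (r θ).2

theorem isStaticScoringRule_menuContract (M : Menu) :
    (menuContract.{u} E M).IsStaticScoringRule (menuRule M) :=
  ⟨Equiv.ulift, fun _ _ => rfl⟩

/-- The strategy that works until `τ` and reports the resulting belief. -/
def truthful (M : Menu) (τ : E.Time) : Strategy (menuContract.{u} E M) where
  effort := (Iic τ).indicator 1
  effort_measurable := measurable_one.indicator measurableSet_Iic
  effort_mem s := by
    by_cases h : s ≤ τ <;> simp [indicator, h]
  noNews _ := ⟨posterior (E.surv τ)⟩
  news s t := if t < s then ⟨posterior (E.surv τ)⟩ else ⟨posterior (E.arr s)⟩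
  nonanticipating s t h := if_pos h
  reward_measurable θ := by
    have h : ∀ s : E.Time, ¬ E.last < s := fun s => not_lt.2 s.2.2
    simp only [menuContract, h, if_false]
    exact ((isProper_menuRule M).measurable θ).comp (measurable_posterior.comp
      (E.continuous_arr.comp continuous_subtype_val).measurable)

theorem utility_truthful (M : Menu) (τ : E.Time) :
    (truthful.{u} M τ).utility = E.value M τ := by
  have hs : (truthful.{u} M τ).StopsAt τ := rfl
  rw [hs.utility_eq, Environment.value]
  congr 1
  · refine intervalIntegral.integral_congr fun z hz => ?_
    rw [uIcc_of_le τ.2.1] at hz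
    have hp : (truthful.{u} M τ).payoff z = menuRule M (posterior (E.arr z)) := by
      have h : ¬ E.last < E.clamp z := not_lt.2 (E.clamp z).2.2
      funext θ
      simp [Strategy.payoff, truthful, menuContract, h, E.coe_clamp ⟨hz.1, hz.2.trans τ.2.2⟩]
    simp only [hp, pairing_menuRule_posterior M (E.arr_nonneg z)]
  · congr 1
    exact pairing_menuRule_posterior M (E.surv_nonneg τ)

theorem hasStoppingTime_menuContract {M : Menu} {τ : E.Time}
    (h : ∀ t : E.Time, E.value M t ≤ E.value M τ) : (menuContract.{u} E M).HasStoppingTime τ := by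
  refine ⟨truthful M τ, rfl, fun σ => ?_⟩
  rw [utility_truthful]
  refine (σ.utility_le_value fun k => ?_).trans (h ⟨_, σ.cum_last_mem⟩)
  obtain ⟨r, hr, e⟩ := menuRule_mem M (k E.last).down
  convert hr using 1
  funext θ
  exact Subtype.ext (congrFun e θ).symm

/-- The latest date that can be implemented by a menu maximizes the value of that menu. -/
theorem Environment.value_le_of_latest (E : Environment) {M : Menu} {τ : E.Time}
    (h : (M, τ) ∈ E.implementable) (hmax : ∀ y ∈ E.implementable, y.2 ≤ τ) (t : E.Time) :
    E.value M t ≤ E.value M τ := by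
  have hle : ∀ s : ℝ, 0 ≤ s → s ≤ τ → E.value M s ≤ E.value M τ := fun s hs hsτ => by
    simpa [min_eq_left hsτ] using h s hs
  have hc : Continuous fun t : E.Time => E.value M t :=
    E.continuous_value.comp (continuous_const.prodMk continuous_subtype_val)
  obtain ⟨v, hv, hvmax⟩ := (isClosed_Ici (a := τ)).isCompact.exists_isMaxOn ⟨τ, self_mem_Ici⟩
    hc.continuousOn
  have hall : ∀ s : E.Time, E.value M s ≤ E.value M v := fun s => by
    rcases le_total s τ with hs | hs
    · exact (hle s s.2.1 hs).trans (hvmax self_mem_Ici)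
    · exact hvmax hs
  have hvτ : v = τ := le_antisymm (hmax (M, v) fun s hs =>
    hall ⟨min s v, le_min hs v.2.1, (min_le_right _ _).trans v.2.2⟩) hv
  exact hvτ ▸ hall t

end SequentialScoring

end

theorem mainTheorem1 (E : SequentialScoring.Environment) :
    ∃ (R : SequentialScoring.Contract.{u} E) (P : SequentialScoring.Belief → Bool → ℝ),
      SequentialScoring.IsProper P ∧ R.IsStaticScoringRule P ∧ R.IsOptimal := by
  obtain ⟨⟨M, τ⟩, h, hmax⟩ := E.exists_latest_implementable
  refine ⟨SequentialScoring.menuContract E M, SequentialScoring.menuRule M,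
    SequentialScoring.isProper_menuRule M, SequentialScoring.isStaticScoringRule_menuContract M, τ,
    SequentialScoring.hasStoppingTime_menuContract (E.value_le_of_latest h hmax), ?_⟩
  intro R' τ' h'
  obtain ⟨M', hM'⟩ := h'.exists_menu
  exact hmax (M', τ') hM'
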